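/- A hypergraph consists of finite sets of vertices, edges and hinges; each hinge attaches one edge to one vertex, and every edge has at least one hinge. Multiple edges are allowed. The degree of a vertex is the number of hinges incident with it. Let $n\ge 1$, and let $r_1,\dots,r_k$ and $\lambda_1,\dots,\lambda_m$ be positive integers. Let $h_1,\dots,h_m\in\{1,\dots,n\}$ be distinct. Write $R=[r_1\cdots r_k]^T$, $\Lambda=[\lambda_1\cdots\lambda_m]^T$ and $H=[h_1\cdots h_m]^T$. Let $\Lambda K_n^H$ be a hypergraph with $n$ vertices such that, for $1\le j\le m$ and every set $U$ of $h_j$ vertices, there are exactly $\lambda_j$ edges attached exactly once to each vertex of $U$ and to no other vertex, and such that there are no other edges. An $R$-factorization of a hypergraph is a partition of its edge set into $F_1,\dots,F_k$ such that, for $1\le i\le k$, in the spanning sub-hypergraph with edge set $F_i$ (all vertices, the edges in $F_i$ and all their hinges) every vertex has degree $r_i$. **Theorem.** $\Lambda K_n^H$ has an $R$-factorization if and only if both of the following hold: 1. $\displaystyle\sum_{i=1}^k r_i=\sum_{j=1}^m \lambda_j\binom{n-1}{h_j-1}$; 2. there is a $k\times m$ matrix $A=[a_{ij}]$ of non-negative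 integers with $AH=nR$ and $\displaystyle\sum_{i=1}^k a_{ij}=\lambda_j\binom{n}{h_j}$ for $1\le j\le m$. -/

import Mathlib

/-- A hypergraph with vertex set `V`, edge set `E` and hinge set `H`. The hinge `x` attaches the
edge `edge x` to the vertex `vert x`; every edge has at least one hinge. Multiple edges and edges
attached several times to one vertex are allowed. Finiteness of the three sets is expressed by
`Finite` instances where hypergraphs are used. -/
structure HingeHypergraph (V E H : Type*) where
  vert : H → V
  edge : H → E
  edge_surjective : Function.Surjective edge

namespace HingeHypergraph

/-- The hinges incident with both the vertex `v` and the edge `e`. -/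
def hingesAt {V E H : Type*} (G : HingeHypergraph V E H) (v : V) (e : E) : Set H :=
  {x | G.vert x = v ∧ G.edge x = e}

/-- The degree of a vertex: the number of hinges incident with it. -/
noncomputable def degree {V E H : Type*} (G : HingeHypergraph V E H) (v : V) : ℕ :=
  {x : H | G.vert x = v}.ncard

/-- Every vertex has degree `r`. -/
def IsRegular {V E H : Type*} (G : HingeHypergraph V E H) (r : ℕ) : Prop :=
  ∀ v, G.degree v = r

open Classical in
/-- The set of edges joining exactly the vertices of the multiset `U`, counted with
multiplicity. -/
def edgesOn {V E H : Type*} (G : HingeHypergraph V E H) (U : Multiset V) : Set E :=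
  {e | ∀ v, (G.hingesAt v e).ncard = U.count v}

/-- The multiplicity of a multiset of vertices: the number of edges joining exactly these
vertices. -/
noncomputable def multiplicity {V E H : Type*} (G : HingeHypergraph V E H) (U : Multiset V) : ℕ :=
  (G.edgesOn U).ncard

/-- The spanning sub-hypergraph of `G` with edge set `F`: all vertices of `G`, the edges in `F`,
and all hinges of these edges. -/
def spanningSub {V E H : Type*} (G : HingeHypergraph V E H) (F : Set E) :
    HingeHypergraph V F {x : H // G.edge x ∈ F} where
  vert x := G.vert x.1
  edge x := ⟨G.edge x.1, x.2⟩
  edge_surjective := by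
    rintro ⟨e, he⟩
    obtain ⟨x, rfl⟩ := G.edge_surjective e
    exact ⟨⟨x, he⟩, rfl⟩

/-- The edge set `F` forms an `r`-factor: an `r`-regular spanning sub-hypergraph. -/
def IsFactor {V E H : Type*} (G : HingeHypergraph V E H) (r : ℕ) (F : Set E) : Prop :=
  (G.spanningSub F).IsRegular r

/-- The edge set of `G` can be partitioned into `F 0, …, F (k - 1)` such that `F i` is an
`r i`-factor. -/
def IsFactorizable {V E H : Type*} (G : HingeHypergraph V E H) {k : ℕ} (r : Fin k → ℕ) : Prop :=
  ∃ F : Fin k → Set E, (Pairwise fun i j => Disjoint (F i) (F j)) ∧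
    (⋃ i, F i) = Set.univ ∧ ∀ i, G.IsFactor (r i) (F i)

/-- `G` is a hypergraph `Λ K_n^H` (with `H` given by `h`): it has `n` vertices, every set of
`h i` vertices is joined by exactly `lam i` edges, and there are no other edges. -/
structure IsLambdaK {V E H : Type*} (G : HingeHypergraph V E H) (n : ℕ) {m : ℕ}
    (lam h : Fin m → ℕ) : Prop where
  card_vertices : Nat.card V = n
  multiplicity_eq : ∀ (i : Fin m) (U : Finset V), U.card = h i → G.multiplicity U.val = lam i
  edge_mem : ∀ e : E, ∃ (i : Fin m) (U : Finset V), U.card = h i ∧ e ∈ G.edgesOn U.val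

/-- The edges of the standard model of `Λ K_n^H` on the vertex set `Fin n`: `lam i` copies of
every `h i`-subset. -/
abbrev LambdaKEdge (n : ℕ) {m : ℕ} (lam h : Fin m → ℕ) : Type :=
  Σ i : Fin m, {U : Finset (Fin n) // U.card = h i} × Fin (lam i)

/-- The standard model of `Λ K_n^H` on the vertex set `Fin n`; hinges are incident pairs. -/
def lambdaK (n : ℕ) {m : ℕ} (lam h : Fin m → ℕ) (hh : ∀ i, 1 ≤ h i) :
    HingeHypergraph (Fin n) (LambdaKEdge n lam h)
      {p : Fin n × LambdaKEdge n lam h // p.1 ∈ p.2.2.1.1} where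
  vert p := p.1.1
  edge p := p.1.2
  edge_surjective := by
    rintro ⟨i, ⟨U, hU⟩, c⟩
    have hne : U.Nonempty := Finset.card_pos.mp (by have := hh i; omega)
    obtain ⟨v, hv⟩ := hne
    exact ⟨⟨(v, ⟨i, ⟨U, hU⟩, c⟩), hv⟩, rfl⟩

theorem lambdaK_mem_edgesOn (n : ℕ) {m : ℕ} (lam h : Fin m → ℕ) (hh : ∀ i, 1 ≤ h i)
    (U : Finset (Fin n)) (e : LambdaKEdge n lam h) :
    e ∈ (lambdaK n lam h hh).edgesOn U.val ↔ e.2.1.1 = U := by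
  classical
  have key : ∀ v, ((lambdaK n lam h hh).hingesAt v e).ncard = if v ∈ e.2.1.1 then 1 else 0 := by
    intro v
    split_ifs with hv
    · rw [Set.ncard_eq_one]
      refine ⟨⟨(v, e), hv⟩, ?_⟩
      ext ⟨⟨w, f⟩, hw⟩
      simp [hingesAt, lambdaK]
    · have : (lambdaK n lam h hh).hingesAt v e = ∅ := by
        ext ⟨⟨w, f⟩, hw⟩
        simp only [hingesAt, lambdaK, Set.mem_ofPred_eq, Set.mem_empty_iff_false, iff_false]
        rintro ⟨rfl, rfl⟩
        exact hv hw
      simp [this]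
  have hc : ∀ v, Multiset.count v U.val = if v ∈ U then 1 else 0 := by
    intro v
    exact Multiset.count_eq_of_nodup U.nodup
  constructor
  · intro he
    ext v
    have h1 := he v
    rw [key v] at h1
    have h2 : (if v ∈ e.2.1.1 then 1 else 0) = if v ∈ U then 1 else 0 := by
      rw [h1, ← hc v]; congr!
    by_cases a : v ∈ e.2.1.1 <;> by_cases b : v ∈ U <;> simp_all
  · intro he v
    rw [key v, he, ← hc v]; congr!

/-- The standard model is a `Λ K_n^H`, so the defining conditions can be met for all
parameters. -/
theorem lambdaK_isLambdaK (n : ℕ) {m : ℕ} (lam h : Fin m → ℕ) (hh : ∀ i, 1 ≤ h i)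
    (hinj : Function.Injective h) : (lambdaK n lam h hh).IsLambdaK n lam h where
  card_vertices := by simp
  multiplicity_eq := by
    intro i U hU
    have : (lambdaK n lam h hh).edgesOn U.val =
        Set.range fun c : Fin (lam i) => (⟨i, ⟨U, hU⟩, c⟩ : LambdaKEdge n lam h) := by
      ext ⟨j, ⟨W, hW⟩, c⟩
      rw [lambdaK_mem_edgesOn]
      constructor
      · intro hWU
        have hWU' : W = U := hWU
        subst hWU'
        have : i = j := hinj (hU.symm.trans hW)
        subst this
        exact ⟨c, rfl⟩
      · rintro ⟨d, hd⟩
        cases hd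
        rfl
    rw [multiplicity, this, ← Set.image_univ, Set.ncard_image_of_injective, Set.ncard_univ]
    · simp
    · intro c d hcd
      simpa using hcd
  edge_mem := by
    rintro ⟨i, ⟨U, hU⟩, c⟩
    exact ⟨i, U, hU, (lambdaK_mem_edgesOn n lam h hh U _).2 rfl⟩

end HingeHypergraph

/-! Necessity is double counting: let `A i j` be the number of edges of size `h j` in the `i`-th
factor. Condition 1 follows from condition 2, so sufficiency needs only the matrix.

For sufficiency, amalgamate all vertices into one; `A` then says how many edges of each size get
each colour. Vertices are split off one at a time. Only the number of edges of each colour and size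
with each trace `S` on the set `L` of split vertices has to be remembered
(`IsPartialFactorization`). A new vertex should receive a fraction `1 / (n - |L|)` of the hinges not
yet placed, in every class. These shares form a matrix, with colours as rows and pairs (size, trace)
as columns, whose row and column sums are integers; `exists_int_rounding` rounds it without changing
the sums, which is what `exists_split` and `exists_insert` need. Once all vertices are split, the
trace is the edge itself, and the counts say how to colour parallel edges. -/

/-! ### Rounding matrices with integral row and column sums -/

theorem Finset.two_mul_card_image_le {α β : Type*} [DecidableEq β] (s : Finset α) (f : α → β)
    (hs : ∀ p ∈ s, ∃ q ∈ s, q ≠ p ∧ f q = f p) : 2 * (s.image f).card ≤ s.card := by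
  classical
  rw [Finset.card_eq_sum_card_image f s, mul_comm]
  refine Finset.card_nsmul_le_sum (s.image f) _ 2 fun b hb => ?_
  obtain ⟨p, hp, rfl⟩ := Finset.mem_image.1 hb
  obtain ⟨q, hq, hne, he⟩ := hs p hp
  exact Finset.one_lt_card.2 ⟨q, by simp [hq, he], p, by simp [hp], hne⟩

/-- A bipartite graph without vertices of degree one carries a nonzero circulation. -/
theorem exists_circulation {α β : Type*} [Fintype α] [Fintype β] (F : Finset (α × β))
    (hF : F.Nonempty) (hrow : ∀ p ∈ F, ∃ q ∈ F, q ≠ p ∧ q.1 = p.1)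
    (hcol : ∀ p ∈ F, ∃ q ∈ F, q ≠ p ∧ q.2 = p.2) :
    ∃ y : α → β → ℚ, (∃ a b, y a b ≠ 0) ∧ (∀ a b, y a b ≠ 0 → (a, b) ∈ F) ∧
      (∀ a, ∑ b, y a b = 0) ∧ ∀ b, ∑ a, y a b = 0 := by
  classical
  obtain ⟨p₀, hp₀⟩ := hF
  -- The row of `p₀` is left out because its equation follows from the others. Rows and columns each
  -- number at most `|F| / 2`, so there are fewer equations than unknowns.
  let T : (F → ℚ) →ₗ[ℚ] (((F.image Prod.fst).erase p₀.1 ⊕ F.image Prod.snd) → ℚ) :=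
    { toFun := fun w => Sum.elim
        (fun a => ∑ p : F, if p.1.1 = a.1 then w p else 0)
        (fun b => ∑ p : F, if p.1.2 = b.1 then w p else 0)
      map_add' := by
        intro w z
        ext (a | b) <;> simp [← Finset.sum_add_distrib] <;>
          exact Finset.sum_congr rfl fun p _ => by split_ifs <;> simp
      map_smul' := by
        intro t w
        ext (a | b) <;> simp [Finset.mul_sum] }
  have hp₀' : p₀.1 ∈ F.image Prod.fst := Finset.mem_image_of_mem _ hp₀
  have hker : LinearMap.ker T ≠ ⊥ := by
    apply LinearMap.ker_ne_bot_of_finrank_lt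
    have h1 := Finset.two_mul_card_image_le F Prod.fst hrow
    have h2 := Finset.two_mul_card_image_le F Prod.snd hcol
    have h3 := Finset.card_pos.2 ⟨_, hp₀'⟩
    simp only [Module.finrank_fintype_fun_eq_card, Fintype.card_sum, Fintype.card_coe,
      Finset.card_erase_of_mem hp₀']
    omega
  obtain ⟨w, hw, hw0⟩ := (Submodule.ne_bot_iff _).1 hker
  have hw : T w = 0 := hw
  let y : α → β → ℚ := fun a b => if h : (a, b) ∈ F then w ⟨(a, b), h⟩ else 0
  have hsum (g : α × β → ℚ) :
      ∑ p : α × β, g p * y p.1 p.2 = ∑ p : F, g p.1 * w p := by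
    rw [← Finset.sum_subset (Finset.subset_univ F), ← Finset.sum_coe_sort]
    · exact Finset.sum_congr rfl fun p _ => by simp [y]
    · intro p _ hp
      simp [y, hp]
  have hr (a : α) : ∑ b, y a b = ∑ p : F, if p.1.1 = a then w p else 0 := by
    have := hsum fun p => if p.1 = a then 1 else 0
    simp only [Fintype.sum_prod_type, ite_mul, one_mul, zero_mul] at this
    rw [← this, Finset.sum_eq_single a] <;> simp +contextual
  have hc (b : β) : ∑ a, y a b = ∑ p : F, if p.1.2 = b then w p else 0 := by
    have := hsum fun p => if p.2 = b then 1 else 0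
    simp only [Fintype.sum_prod_type, ite_mul, one_mul, zero_mul] at this
    rw [← this]
    exact Finset.sum_congr rfl fun a _ => by simp
  have hcz (b : β) : ∑ a, y a b = 0 := by
    by_cases hb : b ∈ F.image Prod.snd
    · rw [hc]
      exact congrFun hw (Sum.inr ⟨b, hb⟩)
    · refine Finset.sum_eq_zero fun a _ => dif_neg fun hab => hb ?_
      exact Finset.mem_image_of_mem Prod.snd hab
  have hrz' (a : α) (ha₀ : a ≠ p₀.1) : ∑ b, y a b = 0 := by
    by_cases ha : a ∈ F.image Prod.fst
    · rw [hr]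
      exact congrFun hw (Sum.inl ⟨a, Finset.mem_erase.2 ⟨ha₀, ha⟩⟩)
    · refine Finset.sum_eq_zero fun b _ => dif_neg fun hab => ha ?_
      exact Finset.mem_image_of_mem Prod.fst hab
  refine ⟨y, ?_, fun a b hab => ?_, fun a => ?_, hcz⟩
  · by_contra! hy
    refine hw0 (funext fun p => ?_)
    have := hy p.1.1 p.1.2
    simpa [y] using this
  · by_contra h
    exact hab (dif_neg h)
  · by_cases ha : a = p₀.1
    · subst ha
      have : ∑ a, ∑ b, y a b = 0 := by
        rw [Finset.sum_comm]
        exact Finset.sum_eq_zero fun b _ => hcz b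
      rwa [Finset.sum_eq_single p₀.1 (fun a _ ha => hrz' a ha) (by simp)] at this
    · exact hrz' a ha

/-- Moving from `x` in a nonzero direction that is supported on non-integral entries, one may stop
when the first entry becomes integral. -/
theorem exists_step_to_integral {ι : Type*} [Fintype ι] (x y : ι → ℚ) (hy : ∃ p, y p ≠ 0)
    (hxy : ∀ p, y p ≠ 0 → Int.fract (x p) ≠ 0) :
    ∃ t : ℚ, (∀ p, (⌊x p⌋ : ℚ) ≤ x p + t * y p ∧ x p + t * y p ≤ ⌈x p⌉) ∧
      ∃ p, Int.fract (x p) ≠ 0 ∧ Int.fract (x p + t * y p) = 0 := by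
  classical
  -- The time at which entry `p` reaches an integer. The minimum is taken over `y p ≠ 0` only, which
  -- excludes the default value of division by zero.
  let g : ι → ℚ := fun p => if 0 < y p then (⌈x p⌉ - x p) / y p else (⌊x p⌋ - x p) / y p
  obtain ⟨q, hq, hmin⟩ := Finset.exists_min_image (Finset.univ.filter fun p => y p ≠ 0) g
    (by obtain ⟨p, hp⟩ := hy; exact ⟨p, by simp [hp]⟩)
  simp only [Finset.mem_filter, Finset.mem_univ, true_and] at hq hmin
  have hfl (p) : (⌊x p⌋ : ℚ) ≤ x p := Int.floor_le _
  have hce (p) : x p ≤ (⌈x p⌉ : ℚ) := Int.le_ceil _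
  have hg0 (p) : 0 ≤ g p := by
    simp only [g]
    split_ifs with h
    · exact div_nonneg (by linarith [hce p]) h.le
    · exact div_nonneg_of_nonpos (by linarith [hfl p]) (not_lt.1 h)
  refine ⟨g q, fun p => ?_, q, hxy q hq, ?_⟩
  · rcases lt_trichotomy (y p) 0 with h | h | h
    · have h1 := hmin p h.ne
      simp only [g, if_neg h.not_gt] at h1
      rw [show (if 0 < y q then (⌈x q⌉ - x q) / y q else (⌊x q⌋ - x q) / y q) = g q from rfl,
        le_div_iff_of_neg h] at h1
      have h2 := mul_nonneg_of_nonpos_of_nonpos (neg_nonpos.2 (hg0 q)) h.le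
      constructor <;> linarith [hce p]
    · simp [h, hfl p, hce p]
    · have h1 := hmin p h.ne'
      simp only [g, if_pos h] at h1
      rw [show (if 0 < y q then (⌈x q⌉ - x q) / y q else (⌊x q⌋ - x q) / y q) = g q from rfl,
        le_div_iff₀ h] at h1
      have h2 := mul_nonneg (hg0 q) h.le
      constructor <;> linarith [hfl p]
  · simp only [g]
    split_ifs with h <;> rw [div_mul_cancel₀ _ hq] <;> simp

/-- This is why no row or column has exactly one non-integral entry, so that the bipartite graph of
these entries carries a circulation. -/
theorem Int.fract_eq_zero_of_sum {ι : Type*} [Fintype ι] (f : ι → ℚ) (z : ℤ) (hz : ∑ i, f i = z)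
    (i : ι) (hi : ∀ j ≠ i, Int.fract (f j) = 0) : Int.fract (f i) = 0 := by
  classical
  have h1 : f i = z - ∑ j ∈ Finset.univ.erase i, f j := by
    rw [← hz, ← Finset.add_sum_erase _ _ (Finset.mem_univ i)]
    ring
  have h2 : ∑ j ∈ Finset.univ.erase i, f j = ((∑ j ∈ Finset.univ.erase i, ⌊f j⌋ : ℤ) : ℚ) := by
    push_cast
    refine Finset.sum_congr rfl fun j hj => ?_
    have := Int.floor_add_fract (f j)
    rw [hi j (Finset.ne_of_mem_erase hj)] at this
    linarith
  rw [h1, h2, ← Int.cast_sub, Int.fract_intCast]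

/-- A rational matrix with integral row and column sums can be rounded to an integral matrix with
the same row and column sums. -/
theorem exists_int_rounding {α β : Type*} [Fintype α] [Fintype β] (x : α → β → ℚ) (R : α → ℤ)
    (C : β → ℤ) (hR : ∀ a, ∑ b, x a b = R a) (hC : ∀ b, ∑ a, x a b = C b) :
    ∃ d : α → β → ℤ, (∀ a b, ⌊x a b⌋ ≤ d a b ∧ d a b ≤ ⌈x a b⌉) ∧
      (∀ a, ∑ b, d a b = R a) ∧ ∀ b, ∑ a, d a b = C b := by
  classical
  -- Each shift along a circulation keeps all sums and integral entries, and makes a further entry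
  -- integral.
  induction hN : (Finset.univ.filter fun p : α × β => Int.fract (x p.1 p.2) ≠ 0).card
    using Nat.strong_induction_on generalizing x with
  | _ N ih =>
  subst hN
  by_cases hF : (Finset.univ.filter fun p : α × β => Int.fract (x p.1 p.2) ≠ 0).Nonempty
  · obtain ⟨y, ⟨a, b, hab⟩, hyF, hyr, hyc⟩ := exists_circulation _ hF
      (by
        rintro ⟨a, b⟩ hp
        by_contra! hne
        refine (Finset.mem_filter.1 hp).2
          (Int.fract_eq_zero_of_sum (x a) _ (hR a) b fun b' hb' => ?_)
        by_contra h0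
        exact hne (a, b') (by simp [h0]) (by simp [hb']) rfl)
      (by
        rintro ⟨a, b⟩ hp
        by_contra! hne
        refine (Finset.mem_filter.1 hp).2
          (Int.fract_eq_zero_of_sum (fun a => x a b) _ (hC b) a fun a' ha' => ?_)
        by_contra h0
        exact hne (a', b) (by simp [h0]) (by simp [ha']) rfl)
    obtain ⟨t, ht, p, hp, hp'⟩ := exists_step_to_integral (fun p : α × β => x p.1 p.2)
      (fun p => y p.1 p.2) ⟨(a, b), hab⟩ fun p hp => by simpa using hyF _ _ hp
    have hlt : (Finset.univ.filter fun p : α × β =>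
        Int.fract (x p.1 p.2 + t * y p.1 p.2) ≠ 0).card <
        (Finset.univ.filter fun p : α × β => Int.fract (x p.1 p.2) ≠ 0).card := by
      refine Finset.card_lt_card ?_
      refine (Finset.ssubset_iff_of_subset fun q hq => ?_).2 ⟨p, by simpa using hp, by simp [hp']⟩
      simp only [Finset.mem_filter, Finset.mem_univ, true_and] at hq ⊢
      contrapose! hq
      have h0 : y q.1 q.2 = 0 := by
        by_contra h
        simpa [hq] using hyF _ _ h
      simp [h0, hq]
    obtain ⟨d, hd, hdR, hdC⟩ := ih _ hlt (fun a b => x a b + t * y a b)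
      (fun a => by rw [Finset.sum_add_distrib, ← Finset.mul_sum, hyr, hR]; simp)
      (fun b => by rw [Finset.sum_add_distrib, ← Finset.mul_sum, hyc, hC]; simp) rfl
    refine ⟨d, fun a b => ⟨?_, ?_⟩, hdR, hdC⟩
    · exact (Int.le_floor.2 (ht (a, b)).1).trans (hd a b).1
    · exact (hd a b).2.trans (Int.ceil_le.2 (ht (a, b)).2)
  · have hx (a b) : (⌊x a b⌋ : ℚ) = x a b := by
      by_contra h
      refine hF ⟨(a, b), ?_⟩
      simp only [Finset.mem_filter, Finset.mem_univ, true_and]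
      intro h0
      have := Int.floor_add_fract (x a b)
      exact h (by rw [h0] at this; linarith)
    refine ⟨fun a b => ⌊x a b⌋, fun a b => ⟨le_rfl, Int.floor_le_ceil _⟩, fun a => ?_, fun b => ?_⟩
    · have := hR a
      rw [Finset.sum_congr rfl fun b _ => (hx a b).symm] at this
      exact_mod_cast this
    · have := hC b
      rw [Finset.sum_congr rfl fun a _ => (hx a b).symm] at this
      exact_mod_cast this

/-! ### Splitting off the vertices one at a time -/

/-- Merging the sets containing `v` with those that do not. -/
theorem Finset.sum_finset_eq_sum_insert {V M : Type*} [Fintype V] [DecidableEq V]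
    [AddCommMonoid M] (v : V) (f : Finset V → M) :
    ∑ S, f S = ∑ S, if v ∈ S then 0 else f S + f (insert v S) := by
  have h : (Finset.univ : Finset (Finset V)) = (insert v (Finset.univ.erase v)).powerset := by
    rw [Finset.insert_erase (Finset.mem_univ v), Finset.powerset_univ]
  have h2 : ∀ g : Finset V → M, ∑ S, g S = ∑ S ∈ (Finset.univ.erase v).powerset, g S +
      ∑ S ∈ (Finset.univ.erase v).powerset, g (insert v S) := fun g => by
    rw [h, Finset.sum_powerset_insert (by simp)]
  rw [h2 f, h2, Finset.sum_eq_zero (s := (Finset.univ.erase v).powerset)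
    (f := fun S => if v ∈ insert v S then 0 else _) (by simp), add_zero, ← Finset.sum_add_distrib]
  refine Finset.sum_congr rfl fun S hS => ?_
  rw [if_neg fun hv => by simpa using Finset.mem_powerset.1 hS hv]

/-- `c i j S` counts the edges of colour `i` and size `h j` that meet the set `L` of vertices
treated so far in `S`, in a colouring of the edges of `Λ K_n^H` that looks like an
`R`-factorization as far as `L` is concerned. -/
structure IsPartialFactorization {V : Type*} [Fintype V] [DecidableEq V] {k m : ℕ}
    (r : Fin k → ℕ) (lam h : Fin m → ℕ) (L : Finset V)
    (c : Fin k → Fin m → Finset V → ℤ) : Prop where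
  nonneg : ∀ i j S, 0 ≤ c i j S
  support : ∀ i j S, c i j S ≠ 0 → S ⊆ L ∧ S.card ≤ h j
  sum_color : ∀ j S, S ⊆ L → S.card ≤ h j →
    ∑ i, c i j S = lam j * (Fintype.card V - L.card).choose (h j - S.card)
  degree : ∀ i, ∀ v ∈ L, ∑ j, ∑ S, (if v ∈ S then c i j S else 0) = r i
  rest : ∀ i, ∑ j, ∑ S, c i j S * ((h j : ℤ) - S.card) = ((Fintype.card V : ℤ) - L.card) * r i

namespace IsPartialFactorization

variable {V : Type*} [Fintype V] [DecidableEq V] {k m : ℕ} {r : Fin k → ℕ} {lam h : Fin m → ℕ}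

theorem empty (A : Fin k → Fin m → ℕ) (hA : ∀ i, ∑ j, A i j * h j = Fintype.card V * r i)
    (hA' : ∀ j, ∑ i, A i j = lam j * (Fintype.card V).choose (h j)) :
    IsPartialFactorization r lam h (∅ : Finset V) fun i j S => if S = ∅ then A i j else 0 where
  nonneg i j S := by split_ifs <;> simp
  support i j S hS := by
    have : S = ∅ := by by_contra h0; simp [h0] at hS
    simp [this]
  sum_color j S hS _ := by
    obtain rfl := Finset.subset_empty.1 hS
    simpa using (by exact_mod_cast hA' j : ∑ i, (A i j : ℤ) = _)
  degree i v hv := by simp at hv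
  rest i := by
    simpa using (by exact_mod_cast hA i : ∑ j, (A i j : ℤ) * h j = _)

/-- Here `d` counts the edges that will contain the next vertex. It is a rounding of the fair
shares, hence lies between 0 and `c` as they do. -/
theorem exists_split {L : Finset V} {c : Fin k → Fin m → Finset V → ℤ}
    (hc : IsPartialFactorization r lam h L c) {N : ℕ} (hN : Fintype.card V = L.card + (N + 1)) :
    ∃ d : Fin k → Fin m → Finset V → ℤ, (∀ i j S, 0 ≤ d i j S) ∧ (∀ i j S, d i j S ≤ c i j S) ∧
      (∀ i j S, d i j S ≠ 0 → S.card < h j) ∧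
      (∀ j S, S ⊆ L → S.card < h j →
        ∑ i, d i j S = lam j * N.choose (h j - S.card - 1)) ∧
      ∀ i, ∑ j, ∑ S, d i j S = r i := by
  have hNV : (Fintype.card V : ℤ) - L.card = N + 1 := by rw [hN]; push_cast; ring
  have hNL : Fintype.card V - L.card = N + 1 := by omega
  have hN0 : (0 : ℚ) < N + 1 := by positivity
  let x : Fin k → Fin m × Finset V → ℚ := fun i q =>
    c i q.1 q.2 * ((h q.1 : ℚ) - q.2.card) / (N + 1)
  have hx (i j S) : x i (j, S) = c i j S * ((h j : ℚ) - S.card) / (N + 1) := rfl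
  have hx0 (i j S) : 0 ≤ x i (j, S) := by
    by_cases h0 : c i j S = 0
    · simp [hx, h0]
    · have h1 : (0 : ℚ) ≤ c i j S := by exact_mod_cast hc.nonneg i j S
      have h2 : (S.card : ℚ) ≤ h j := by exact_mod_cast (hc.support i j S h0).2
      rw [hx]
      exact div_nonneg (mul_nonneg h1 (by linarith)) hN0.le
  have hxc (i j S) : x i (j, S) ≤ c i j S := by
    by_cases h0 : c i j S = 0
    · simp [hx, h0]
    · have h1 : (0 : ℚ) ≤ c i j S := by exact_mod_cast hc.nonneg i j S
      obtain ⟨hSL, hSh⟩ := hc.support i j S h0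
      -- An edge cannot have more hinges left than there are vertices left: otherwise the binomial
      -- coefficient in `sum_color` vanishes, and with it every `c i j S`.
      have h2 : h j - S.card ≤ N + 1 := by
        by_contra! hlt
        have h3 := hc.sum_color j S hSL hSh
        rw [hNL, Nat.choose_eq_zero_of_lt hlt] at h3
        simp only [Nat.cast_zero, mul_zero] at h3
        exact h0 ((Finset.sum_eq_zero_iff_of_nonneg fun i _ => hc.nonneg i j S).1 h3 i
          (Finset.mem_univ i))
      have h3 : (h j : ℚ) ≤ N + 1 + S.card := by exact_mod_cast (by omega : h j ≤ N + 1 + S.card)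
      rw [hx, div_le_iff₀ hN0]
      exact mul_le_mul_of_nonneg_left (by linarith) h1
  let C : Fin m × Finset V → ℤ := fun q =>
    if q.2 ⊆ L ∧ q.2.card < h q.1 then lam q.1 * N.choose (h q.1 - q.2.card - 1) else 0
  obtain ⟨d, hd, hdR, hdC⟩ := exists_int_rounding x (fun i => r i) C
    (fun i => by
      rw [Fintype.sum_prod_type]
      have h1 : ((∑ j, ∑ S, c i j S * ((h j : ℤ) - S.card) : ℤ) : ℚ) =
        (((N : ℤ) + 1) * r i : ℤ) := by rw [hc.rest i, hNV]
      push_cast at h1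
      simp_rw [hx, ← Finset.sum_div]
      rw [h1]
      field_simp
      simp)
    (by
      rintro ⟨j, S⟩
      simp_rw [hx, ← Finset.sum_div, ← Finset.sum_mul]
      by_cases hS : S ⊆ L ∧ S.card ≤ h j
      · have h1 : ((∑ i, c i j S : ℤ) : ℚ) = _ := congrArg _ (hc.sum_color j S hS.1 hS.2)
        push_cast at h1
        rw [h1, hNL]
        simp only [C, hS.1, true_and]
        split_ifs with hlt
        · obtain ⟨t, ht⟩ : ∃ t, h j = S.card + (t + 1) := ⟨h j - S.card - 1, by omega⟩
          -- The absorption identity cancels the denominator, so the column sum is an integer.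
          have h2 : ((N + 1).choose (t + 1) : ℚ) * (t + 1) = (N + 1) * N.choose t := by
            exact_mod_cast (Nat.add_one_mul_choose_eq N t).symm
          have h3 : h j - S.card = t + 1 := by omega
          rw [h3, ht]
          push_cast
          rw [add_sub_cancel_left, mul_assoc, h2]
          field_simp
        · have h3 : h j = S.card := by omega
          simp [h3]
      · have h0 (i) : c i j S = 0 := by
          by_contra h0
          exact hS (hc.support i j S h0)
        have : ¬ (S ⊆ L ∧ S.card < h j) := fun h => hS ⟨h.1, h.2.le⟩
        simp [h0, C, this])
  refine ⟨fun i j S => d i (j, S), fun i j S => ?_, fun i j S => ?_, fun i j S hS => ?_,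
    fun j S hSL hS => ?_, fun i => ?_⟩
  · exact (Int.floor_nonneg.2 (hx0 i j S)).trans (hd i (j, S)).1
  · exact (hd i (j, S)).2.trans (Int.ceil_le.2 (hxc i j S))
  · by_contra hlt
    have hxz : x i (j, S) = 0 := by
      by_cases h0 : c i j S = 0
      · simp [hx, h0]
      · have : h j = S.card := le_antisymm (not_lt.1 hlt) (hc.support i j S h0).2
        simp [hx, this]
    have := hd i (j, S)
    rw [hxz] at this
    simp at this
    exact hS (le_antisymm this.2 this.1)
  · have := hdC (j, S)
    simpa only [C, hSL, hS, and_self, if_true] using this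
  · have := hdR i
    rwa [Fintype.sum_prod_type] at this

theorem exists_insert {L : Finset V} {c : Fin k → Fin m → Finset V → ℤ}
    (hc : IsPartialFactorization r lam h L c) {v : V} (hv : v ∉ L) :
    ∃ c', IsPartialFactorization r lam h (insert v L) c' := by
  have hcard := Finset.card_insert_of_notMem hv
  have hlt : L.card < Fintype.card V := by
    have := Finset.card_le_univ (insert v L)
    omega
  obtain ⟨N, hN⟩ : ∃ N, Fintype.card V = L.card + (N + 1) :=
    ⟨Fintype.card V - L.card - 1, by omega⟩
  obtain ⟨d, hd0, hdc, hdh, hdC, hdR⟩ := hc.exists_split hN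
  have hNV : Fintype.card V - L.card = N + 1 := by omega
  have hNV' : Fintype.card V - (insert v L).card = N := by omega
  have hcv (i j) {S : Finset V} (hS : v ∈ S) : c i j S = 0 := by
    by_contra h0
    exact hv ((hc.support i j S h0).1 hS)
  have hdv (i j) {S : Finset V} (hS : v ∈ S) : d i j S = 0 :=
    le_antisymm ((hdc i j S).trans (hcv i j hS).le) (hd0 i j S)
  -- Of the edges with trace `S`, those counted by `d` move to `insert v S` and the others keep
  -- their trace.
  let c' : Fin k → Fin m → Finset V → ℤ := fun i j S =>
    if v ∈ S then d i j (S.erase v) else c i j S - d i j S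
  have hc' (i j) (g : Finset V → ℤ) : ∑ S, c' i j S * g S =
      ∑ S, ((c i j S - d i j S) * g S + d i j S * g (insert v S)) := by
    rw [Finset.sum_finset_eq_sum_insert v]
    refine Finset.sum_congr rfl fun S _ => ?_
    by_cases hS : v ∈ S
    · simp [hS, hcv, hdv]
    · simp [c', hS]
  refine ⟨c', ⟨fun i j S => ?_, fun i j S hS => ?_, fun j S hSL hS => ?_, fun i w hw => ?_,
    fun i => ?_⟩⟩
  · simp only [c']
    split_ifs
    · exact hd0 _ _ _
    · exact sub_nonneg.2 (hdc _ _ _)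
  · simp only [c'] at hS
    split_ifs at hS with hvS
    · have h1 := hdh _ _ _ hS
      have h2 : c i j (S.erase v) ≠ 0 := fun h0 =>
        hS (le_antisymm ((hdc _ _ _).trans h0.le) (hd0 _ _ _))
      rw [Finset.card_erase_of_mem hvS] at h1
      exact ⟨Finset.erase_subset_iff_of_mem (Finset.mem_insert_self v L) |>.1
        ((hc.support _ _ _ h2).1.trans (Finset.subset_insert v L)), by omega⟩
    · have h2 : c i j S ≠ 0 := fun h0 => hS (by
        have := hdc i j S
        have := hd0 i j S
        omega)
      exact ⟨(hc.support _ _ _ h2).1.trans (Finset.subset_insert v L), (hc.support _ _ _ h2).2⟩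
  · rw [hNV']
    by_cases hvS : v ∈ S
    · have h0 := Finset.card_pos.2 ⟨v, hvS⟩
      have h1 := Finset.card_erase_of_mem hvS
      simp only [c', if_pos hvS]
      rw [hdC j (S.erase v) (Finset.subset_insert_iff.1 hSL) (by omega), h1]
      congr 3
      omega
    · have hSL' : S ⊆ L := (Finset.subset_insert_iff_of_notMem hvS).1 hSL
      simp only [c', if_neg hvS]
      rw [Finset.sum_sub_distrib, hc.sum_color j S hSL' hS, hNV]
      rcases hS.lt_or_eq with hS' | hS'
      · obtain ⟨t, ht⟩ : ∃ t, h j - S.card = t + 1 := ⟨h j - S.card - 1, by omega⟩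
        -- Pascal's rule: the edges that avoid `v` are what remains.
        rw [hdC j S hSL' hS', ht, Nat.choose_succ_succ]
        push_cast
        ring
      · have h0 (i : Fin k) : d i j S = 0 := by
          by_contra h0
          exact (hdh i j S h0).ne hS'
        simp [h0, hS']
  · have h1 (j) : ∑ S, (if w ∈ S then c' i j S else 0) =
        ∑ S, ((c i j S - d i j S) * (if w ∈ S then 1 else 0) +
          d i j S * (if w ∈ insert v S then 1 else 0)) := by
      rw [← hc' i j fun S => if w ∈ S then 1 else 0]
      simp
    simp_rw [h1]
    rcases Finset.mem_insert.1 hw with rfl | hwL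
    · rw [← hdR i]
      refine Finset.sum_congr rfl fun j _ => Finset.sum_congr rfl fun S _ => ?_
      by_cases hS : w ∈ S <;> simp [hS, hcv, hdv]
    · rw [← hc.degree i w hwL]
      have hwv : w ≠ v := fun h => hv (h ▸ hwL)
      refine Finset.sum_congr rfl fun j _ => Finset.sum_congr rfl fun S _ => ?_
      by_cases hS : w ∈ S <;> simp [hS, hwv]
  · have h1 := hc.rest i
    have h2 := hdR i
    have h3 : ∑ j, ∑ S, c' i j S * ((h j : ℤ) - S.card) =
        ∑ j, ∑ S, (c i j S * ((h j : ℤ) - S.card) - d i j S) := by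
      refine Finset.sum_congr rfl fun j _ => ?_
      rw [hc' i j fun S => (h j : ℤ) - S.card]
      refine Finset.sum_congr rfl fun S _ => ?_
      by_cases hS : v ∈ S
      · simp [hcv, hdv, hS]
      · rw [Finset.card_insert_of_notMem hS]
        push_cast
        ring
    simp only [Finset.sum_sub_distrib] at h3
    rw [h3, h1, h2, hcard]
    push_cast
    ring

theorem exists_univ (A : Fin k → Fin m → ℕ)
    (hA : ∀ i, ∑ j, A i j * h j = Fintype.card V * r i)
    (hA' : ∀ j, ∑ i, A i j = lam j * (Fintype.card V).choose (h j)) :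
    ∃ c, IsPartialFactorization r lam h (Finset.univ : Finset V) c := by
  induction (Finset.univ : Finset V) using Finset.induction_on with
  | empty => exact ⟨_, empty A hA hA'⟩
  | insert v L hv ih =>
    obtain ⟨c, hc⟩ := ih
    exact hc.exists_insert hv

end IsPartialFactorization

/-! ### Colourings with prescribed counts, and condition 1 -/

theorem exists_coloring_of_sum_eq_card {α : Type*} [Fintype α] {k : ℕ} (c : Fin k → ℕ)
    (hc : ∑ i, c i = Fintype.card α) :
    ∃ f : α → Fin k, ∀ i, (Finset.univ.filter fun a => f a = i).card = c i := by
  have e : α ≃ Σ i, Fin (c i) := Fintype.equivOfCardEq (by simp [hc])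
  refine ⟨fun a => (e a).1, fun i => ?_⟩
  rw [← Fintype.card_fin (c i), ← Finset.card_univ]
  symm
  refine Finset.card_bij (fun x _ => e.symm ⟨i, x⟩) (by simp) (by simp) fun a ha => ?_
  obtain rfl : (e a).1 = i := by simpa using ha
  exact ⟨(e a).2, Finset.mem_univ _, by simp⟩

/-- Colour every fibre of `σ` with prescribed numbers of elements of each colour. -/
theorem exists_coloring_fiberwise {E W : Type*} [Fintype E] [DecidableEq W] {k : ℕ} (σ : E → W)
    (C : Fin k → W → ℕ)
    (hC : ∀ U, ∑ i, C i U = (Finset.univ.filter fun e => σ e = U).card) :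
    ∃ col : E → Fin k, ∀ i U,
      (Finset.univ.filter fun e => col e = i ∧ σ e = U).card = C i U := by
  choose f hf using fun U => exists_coloring_of_sum_eq_card (α := {e // σ e = U})
    (fun i => C i U) (by rw [hC, Fintype.card_subtype])
  refine ⟨fun e => f (σ e) ⟨e, rfl⟩, fun i U => ?_⟩
  rw [← hf U i]
  symm
  refine Finset.card_bij (fun e _ => e.1) ?_ (fun _ _ _ _ h => Subtype.ext h) ?_
  · rintro ⟨e, rfl⟩ he
    simpa using he
  · intro e he
    obtain ⟨h1, rfl⟩ := (Finset.mem_filter.1 he).2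
    exact ⟨⟨e, rfl⟩, by simpa using h1, rfl⟩

/-- Both sides times `n` count all hinges, by `n * (n - 1).choose (h - 1) = h * n.choose h`. -/
theorem sum_eq_sum_choose_of_mulVec_eq {n k m : ℕ} (hn : 1 ≤ n) {r : Fin k → ℕ}
    {lam h : Fin m → ℕ} (hh : ∀ j, 1 ≤ h j) (A : Fin k → Fin m → ℕ)
    (hA : ∀ i, ∑ j, A i j * h j = n * r i) (hA' : ∀ j, ∑ i, A i j = lam j * n.choose (h j)) :
    ∑ i, r i = ∑ j, lam j * (n - 1).choose (h j - 1) := by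
  refine Nat.eq_of_mul_eq_mul_left hn ?_
  rw [Finset.mul_sum, ← Finset.sum_congr rfl fun i _ => hA i, Finset.sum_comm, Finset.mul_sum]
  refine Finset.sum_congr rfl fun j _ => ?_
  rw [← Finset.sum_mul, hA']
  obtain ⟨N, rfl⟩ : ∃ N, n = N + 1 := ⟨n - 1, by omega⟩
  obtain ⟨t, ht⟩ : ∃ t, h j = t + 1 := ⟨h j - 1, by have := hh j; omega⟩
  rw [ht, Nat.add_sub_cancel, Nat.add_sub_cancel, mul_assoc, ← Nat.add_one_mul_choose_eq]
  ring

/-! ### Factorizations as edge colourings, and the two directions -/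

namespace HingeHypergraph

variable {V E H : Type*} {G : HingeHypergraph V E H}

theorem mem_edgesOn_val [DecidableEq V] {U : Finset V} {e : E} :
    e ∈ G.edgesOn U.val ↔ ∀ v, (G.hingesAt v e).ncard = if v ∈ U then 1 else 0 := by
  have hc (v) : U.val.count v = if v ∈ U then 1 else 0 := Multiset.count_eq_of_nodup U.nodup
  simp_rw [← hc]
  unfold edgesOn
  simp only [Set.mem_ofPred_eq]
  refine forall_congr' fun v => ?_
  congr!

theorem eq_of_mem_edgesOn {U W : Finset V} {e : E} (hU : e ∈ G.edgesOn U.val)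
    (hW : e ∈ G.edgesOn W.val) : U = W := by
  classical
  ext v
  have h := (mem_edgesOn_val.1 hU v).symm.trans (mem_edgesOn_val.1 hW v)
  by_cases h1 : v ∈ U <;> by_cases h2 : v ∈ W <;> simp_all

/-- No edge is attached twice to `v`, so hinges at `v` correspond to edges through `v`. -/
theorem degree_spanningSub [Finite H] [Fintype E] [DecidableEq V] {supp : E → Finset V}
    (hs : ∀ e, e ∈ G.edgesOn (supp e).val) (F : Set E) [DecidablePred (· ∈ F)] (v : V) :
    (G.spanningSub F).degree v = (Finset.univ.filter fun e => e ∈ F ∧ v ∈ supp e).card := by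
  have hs' (e) := mem_edgesOn_val.1 (hs e) v
  have himg : (fun x : {x : H // G.edge x ∈ F} => G.edge x.1) ''
      {x | (G.spanningSub F).vert x = v} =
      ((Finset.univ.filter fun e => e ∈ F ∧ v ∈ supp e : Finset E) : Set E) := by
    ext e
    simp only [Set.mem_image, Finset.coe_filter, Finset.mem_univ, true_and]
    constructor
    · rintro ⟨⟨x, hx⟩, hxv, rfl⟩
      refine ⟨hx, ?_⟩
      by_contra hv
      have h0 := hs' (G.edge x)
      rw [if_neg hv, Set.ncard_eq_zero] at h0
      exact (h0 ▸ (⟨hxv, rfl⟩ : x ∈ G.hingesAt v (G.edge x)) : x ∈ (∅ : Set H))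
    · rintro ⟨heF, hv⟩
      have h1 := hs' e
      rw [if_pos hv] at h1
      obtain ⟨x, hx⟩ := Set.nonempty_of_ncard_ne_zero (h1 ▸ one_ne_zero)
      obtain ⟨hxv, rfl⟩ := hx
      exact ⟨⟨x, heF⟩, hxv, rfl⟩
  rw [degree, ← Set.ncard_coe_finset, ← himg, Set.InjOn.ncard_image]
  rintro ⟨x, hx⟩ hxv ⟨y, hy⟩ hyv hxy
  have h1 : (G.hingesAt v (G.edge x)).ncard ≤ 1 := by
    rw [hs']
    split_ifs <;> simp
  exact Subtype.ext ((Set.ncard_le_one).1 h1 x ⟨hxv, rfl⟩ y ⟨hyv, hxy.symm⟩)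

/-- A factorization is the same as a colouring of the edges with prescribed degrees. -/
theorem isFactorizable_iff_exists_coloring [Finite H] [Fintype E] [DecidableEq V]
    {supp : E → Finset V} (hs : ∀ e, e ∈ G.edgesOn (supp e).val) {k : ℕ} {r : Fin k → ℕ} :
    G.IsFactorizable r ↔ ∃ col : E → Fin k, ∀ i v,
      (Finset.univ.filter fun e => col e = i ∧ v ∈ supp e).card = r i := by
  classical
  constructor
  · rintro ⟨F, hd, hu, hF⟩
    have hex (e : E) : ∃ i, e ∈ F i := Set.mem_iUnion.1 (hu ▸ Set.mem_univ e)
    choose col hcol using hex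
    have hiff (e i) : e ∈ F i ↔ col e = i := by
      constructor
      · intro he
        by_contra hne
        exact Set.disjoint_left.1 (hd hne) (hcol e) he
      · rintro rfl
        exact hcol e
    refine ⟨col, fun i v => ?_⟩
    rw [← hF i v, degree_spanningSub hs]
    simp_rw [hiff]
  · rintro ⟨col, hcol⟩
    refine ⟨fun i => {e | col e = i}, fun i j hij => ?_, ?_, fun i v => ?_⟩
    · refine Set.disjoint_left.2 ?_
      rintro e rfl he
      exact hij he
    · ext e
      simp
    · rw [degree_spanningSub hs, ← hcol i v]
      congr!

namespace IsLambdaK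

variable {n m : ℕ} {lam h : Fin m → ℕ}

theorem exists_supp (hG : G.IsLambdaK n lam h) :
    ∃ supp : E → Finset V, (∀ e, e ∈ G.edgesOn (supp e).val) ∧ ∀ e, ∃ j, (supp e).card = h j := by
  choose j U hU he using hG.edge_mem
  exact ⟨U, he, fun e => ⟨j e, hU e⟩⟩

theorem card_filter_supp_eq [Fintype E] [DecidableEq V] (hG : G.IsLambdaK n lam h)
    (hinj : Function.Injective h) {supp : E → Finset V}
    (hs : ∀ e, e ∈ G.edgesOn (supp e).val) (hsh : ∀ e, ∃ j, (supp e).card = h j) (U : Finset V) :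
    (Finset.univ.filter fun e => supp e = U).card =
      ∑ j, if U.card = h j then lam j else 0 := by
  by_cases hU : ∃ j, U.card = h j
  · obtain ⟨j, hj⟩ := hU
    rw [Finset.sum_eq_single j (fun j' _ hne => if_neg fun h' => hne (hinj (h'.symm.trans hj)))
      (by simp), if_pos hj, ← hG.multiplicity_eq j U hj, multiplicity, ← Set.ncard_coe_finset]
    congr 1
    ext e
    simp only [Finset.coe_filter, Finset.mem_univ, true_and, Set.mem_ofPred_eq]
    constructor
    · rintro rfl
      exact hs e
    · exact fun he => eq_of_mem_edgesOn (hs e) he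
  · push Not at hU
    rw [Finset.sum_eq_zero fun j _ => if_neg (hU j), Finset.card_eq_zero,
      Finset.filter_eq_empty_iff]
    rintro e - rfl
    obtain ⟨j, hj⟩ := hsh e
    exact hU j hj

variable [Fintype V] [Fintype E] [DecidableEq V] {k : ℕ} {r : Fin k → ℕ} {supp : E → Finset V}

theorem exists_counts_of_coloring (hG : G.IsLambdaK n lam h) (hinj : Function.Injective h)
    (hs : ∀ e, e ∈ G.edgesOn (supp e).val) (hsh : ∀ e, ∃ j, (supp e).card = h j)
    {col : E → Fin k}
    (hcol : ∀ i v, (Finset.univ.filter fun e => col e = i ∧ v ∈ supp e).card = r i) :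
    ∃ A : Fin k → Fin m → ℕ, (∀ i, ∑ j, A i j * h j = n * r i) ∧
      ∀ j, ∑ i, A i j = lam j * n.choose (h j) := by
  have hV : Fintype.card V = n := by rw [← Nat.card_eq_fintype_card, hG.card_vertices]
  refine ⟨fun i j => (Finset.univ.filter fun e => col e = i ∧ (supp e).card = h j).card,
    fun i => ?_, fun j => ?_⟩
  · have hcard (e) : (supp e).card = ∑ j, if (supp e).card = h j then h j else 0 := by
      obtain ⟨j, hj⟩ := hsh e
      rw [Finset.sum_eq_single j (fun j' _ hne => if_neg fun h' => hne (hinj (h'.symm.trans hj)))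
        (by simp), if_pos hj, hj]
    -- Both ends count the incidences of colour `i`, by edges and by vertices.
    calc _ = ∑ j, ∑ e, (if col e = i then (if (supp e).card = h j then h j else 0) else 0) := by
          refine Finset.sum_congr rfl fun j _ => ?_
          dsimp only
          rw [Finset.card_filter, Finset.sum_mul]
          refine Finset.sum_congr rfl fun e _ => ?_
          by_cases h1 : col e = i <;> by_cases h2 : (supp e).card = h j <;> simp [h1, h2]
      _ = ∑ e, if col e = i then (supp e).card else 0 := by
          rw [Finset.sum_comm]
          refine Finset.sum_congr rfl fun e _ => ?_
          split_ifs
          · exact (hcard e).symm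
          · simp
      _ = ∑ v, ∑ e, if col e = i ∧ v ∈ supp e then 1 else 0 := by
          rw [Finset.sum_comm]
          refine Finset.sum_congr rfl fun e _ => ?_
          by_cases h1 : col e = i <;> simp [h1]
      _ = n * r i := by
          simp_rw [← Finset.card_filter, hcol]
          simp [hV]
  · calc _ = (Finset.univ.filter fun e => (supp e).card = h j).card := by
          rw [Finset.card_eq_sum_card_fiberwise (f := col) (t := Finset.univ) (by simp)]
          simp_rw [Finset.filter_filter, and_comm]
      _ = ∑ U ∈ Finset.univ.powersetCard (h j), (Finset.univ.filter fun e => supp e = U).card := by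
          rw [Finset.card_eq_sum_card_fiberwise (f := supp)
            (t := Finset.univ.powersetCard (h j)) (by intro e; simp)]
          refine Finset.sum_congr rfl fun U hU => ?_
          rw [Finset.filter_filter]
          congr 1
          ext e
          have := (Finset.mem_powersetCard.1 hU).2
          simp only [Finset.mem_filter, Finset.mem_univ, true_and, and_iff_right_iff_imp]
          rintro rfl
          exact this
      _ = ∑ U ∈ (Finset.univ : Finset V).powersetCard (h j), lam j := by
          refine Finset.sum_congr rfl fun U hU => ?_
          have hj := (Finset.mem_powersetCard.1 hU).2
          rw [hG.card_filter_supp_eq hinj hs hsh, Finset.sum_eq_single j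
            (fun j' _ hne => if_neg fun h' => hne (hinj (h'.symm.trans hj))) (by simp), if_pos hj]
      _ = lam j * n.choose (h j) := by
          rw [Finset.sum_const, Finset.card_powersetCard, Finset.card_univ, hV, smul_eq_mul,
            mul_comm]

/-- With every vertex split off, the binomial coefficient in `sum_color` is `Nat.choose 0 (h j -
U.card)`. So only sets of size `h j` carry edges, `lam j` each, and the parallel edges on `U` can be
coloured by the counts. -/
theorem exists_coloring_of_counts (hG : G.IsLambdaK n lam h) (hinj : Function.Injective h)
    (hs : ∀ e, e ∈ G.edgesOn (supp e).val) (hsh : ∀ e, ∃ j, (supp e).card = h j)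
    (A : Fin k → Fin m → ℕ) (hA : ∀ i, ∑ j, A i j * h j = n * r i)
    (hA' : ∀ j, ∑ i, A i j = lam j * n.choose (h j)) :
    ∃ col : E → Fin k, ∀ i v,
      (Finset.univ.filter fun e => col e = i ∧ v ∈ supp e).card = r i := by
  have hV : Fintype.card V = n := by rw [← Nat.card_eq_fintype_card, hG.card_vertices]
  subst hV
  obtain ⟨c, hc⟩ := IsPartialFactorization.exists_univ (V := V) A hA hA'
  have hsum (j) (U : Finset V) : ∑ i, c i j U = if U.card = h j then (lam j : ℤ) else 0 := by
    by_cases hU : U.card ≤ h j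
    · rw [hc.sum_color j U (Finset.subset_univ U) hU, Finset.card_univ, Nat.sub_self]
      rcases hU.lt_or_eq with hlt | heq
      · rw [if_neg hlt.ne, Nat.choose_eq_zero_of_lt (by omega)]
        simp
      · simp [heq]
    · rw [if_neg (by omega)]
      refine Finset.sum_eq_zero fun i _ => ?_
      by_contra h0
      exact hU (hc.support i j U h0).2
  have hcast (i j U) : ((c i j U).toNat : ℤ) = c i j U := Int.toNat_of_nonneg (hc.nonneg i j U)
  -- At most one `j` contributes, the one with `U.card = h j`.
  obtain ⟨col, hcol⟩ := exists_coloring_fiberwise supp (fun i U => ∑ j, (c i j U).toNat)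
    (fun U => by
      rw [hG.card_filter_supp_eq hinj hs hsh, Finset.sum_comm]
      refine Finset.sum_congr rfl fun j _ => ?_
      have := hsum j U
      rw [← Finset.sum_congr rfl fun i _ => hcast i j U] at this
      exact_mod_cast this)
  refine ⟨col, fun i v => ?_⟩
  have h1 : (Finset.univ.filter fun e => col e = i ∧ v ∈ supp e).card =
      ∑ U, if v ∈ U then ∑ j, (c i j U).toNat else 0 := by
    rw [Finset.card_eq_sum_card_fiberwise (f := supp) (t := Finset.univ) (by simp)]
    refine Finset.sum_congr rfl fun U _ => ?_
    rw [Finset.filter_filter]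
    split_ifs with hv
    · rw [← hcol i U]
      congr 1
      ext e
      simp only [Finset.mem_filter, Finset.mem_univ, true_and]
      constructor
      · exact fun h => ⟨h.1.1, h.2⟩
      · rintro ⟨h1, rfl⟩
        exact ⟨⟨h1, hv⟩, rfl⟩
    · rw [Finset.card_eq_zero, Finset.filter_eq_empty_iff]
      rintro e - ⟨⟨-, h1⟩, rfl⟩
      exact hv h1
  have h2 := hc.degree i v (Finset.mem_univ v)
  rw [Finset.sum_comm] at h2
  zify
  rw [h1, ← h2]
  push_cast
  refine Finset.sum_congr rfl fun U _ => ?_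
  split_ifs with hv
  · simp only [hcast]
  · simp

end IsLambdaK

end HingeHypergraph

theorem theorem6p1 {V E H : Type*} [Finite V] [Finite E] [Finite H]
    (G : HingeHypergraph V E H) (n k m : ℕ) (hn : 1 ≤ n)
    (r : Fin k → ℕ) (lam h : Fin m → ℕ)
    (hr : ∀ i, 1 ≤ r i) (hlam : ∀ j, 1 ≤ lam j)
    (hh : ∀ j, 1 ≤ h j ∧ h j ≤ n) (hinj : Function.Injective h)
    (hG : G.IsLambdaK n lam h) :
    G.IsFactorizable r ↔
      ((∑ i, r i = ∑ j, lam j * (n - 1).choose (h j - 1)) ∧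
        ∃ A : Matrix (Fin k) (Fin m) ℕ, A.mulVec h = n • r ∧
          ∀ j, ∑ i, A i j = lam j * n.choose (h j)) := by
  classical
  have := Fintype.ofFinite V
  have := Fintype.ofFinite E
  obtain ⟨supp, hs, hsh⟩ := hG.exists_supp
  rw [HingeHypergraph.isFactorizable_iff_exists_coloring hs]
  constructor
  · rintro ⟨col, hcol⟩
    obtain ⟨A, hA, hA'⟩ := hG.exists_counts_of_coloring hinj hs hsh hcol
    exact ⟨sum_eq_sum_choose_of_mulVec_eq hn (fun j => (hh j).1) A hA hA', A, funext hA, hA'⟩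
  · rintro ⟨-, A, hA, hA'⟩
    exact hG.exists_coloring_of_counts hinj hs hsh A (fun i => congrFun hA i) hA'
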